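/- All graphs are finite, simple, undirected and have at least one vertex. Let $0\le\alpha\le 1$, and let $(G_n,d_n)_{n}$ be a sequence in which $d_n\ge 1$ is a real number and $G_n$ is a graph with all degrees at most $d_n$. Assume that - the sequence is $\alpha$-regular: the degree of a uniform random vertex of $G_n$, divided by $d_n$, tends to $\alpha$ in probability as $n\to\infty$; - the sequence has large girth: for every $k\ge 3$ there is an $n_0(k)$ such that for all $n\ge n_0(k)$ there is no injective homomorphism from the cycle $C_k$ to $G_n$; - $d_n\to\infty$. Let $\Sigma_n$ be the uniform probability measure on the points $\lambda/\sqrt{d_n}$, where $\lambda$ runs over the eigenvalues of the adjacency matrix of $G_n$, counted with multiplicity, and let $w(x)=\frac{\sqrt{4-x^2}}{2\pi}$ for $-2\le x\le 2$. Then each $\Sigma_n$ is supported on $[-\sqrt{d_n},\sqrt{d_n}]$, and for each integer $k\ge 0$, $$\int_{-\sqrt{d_n}}^{\sqrt{d_n}}x^k\,\mathrm d\Sigma_n(x)\to\int_{-2}^{2}\left(\sqrt\alpha\,x\right)^k w(x)\,\mathrm dx\qquad(n\to\infty).$$ Moreover, $\Sigma_n$ converges weakly to the semicircle distribution on $[-2\sqrt\alpha,2\sqrt\alpha]$,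 that is, to the distribution of $\sqrt\alpha\,X$, where $X$ is a random variable with density $w$ on $[-2,2]$. -/

import Mathlib

open Filter Topology MeasureTheory
open scoped ENNReal

universe u

/-- The number `inj(F, G)` of injective homomorphisms from `F` to `G`. -/
noncomputable def injCount {W : Type*} {V : Type*} (F : SimpleGraph W) (G : SimpleGraph V) : ℕ :=
  Nat.card {f : F →g G // Function.Injective f}

/-- The pair `(G, d)` is admissible: `d ≥ 1` and all degrees of the finite graph `G` are at
most `d`. -/
def IsAdmissible {V : Type*} [Fintype V] (G : SimpleGraph V) [DecidableRel G.Adj] (d : ℝ) : Prop :=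
  1 ≤ d ∧ ∀ v, (G.degree v : ℝ) ≤ d

/-- The probability that a uniform random element of the finite type `V` satisfies `P`. -/
noncomputable def uniformProb (V : Type*) [Fintype V] (P : V → Prop) : ℝ :=
  (Nat.card {v : V // P v} : ℝ) / (Fintype.card V : ℝ)

/-- The sequence `(G n, d n)` is admissible and `α`-regular: `0 ≤ α ≤ 1`, and the degree of a
uniform random vertex of `G n`, divided by `d n`, tends to `α` in probability. -/
structure IsRegularSeq {V : ℕ → Type u} [∀ n, Fintype (V n)] (G : ∀ n, SimpleGraph (V n))
    [∀ n, DecidableRel (G n).Adj] (d : ℕ → ℝ) (α : ℝ) : Prop where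
  nonneg : 0 ≤ α
  le_one : α ≤ 1
  admissible : ∀ n, IsAdmissible (G n) (d n)
  tendsto_prob : ∀ ε : ℝ, 0 < ε →
    Tendsto (fun n => uniformProb (V n) (fun v => ε ≤ |((G n).degree v : ℝ) / d n - α|))
      atTop (𝓝 0)

/-- The graph sequence `G n` has large girth: for every `k ≥ 3`, `inj(C_k, G n) = 0` for all
sufficiently large `n`. -/
def HasLargeGirth {V : ℕ → Type u} (G : ∀ n, SimpleGraph (V n)) : Prop :=
  ∀ k : ℕ, 3 ≤ k → ∃ n₀ : ℕ, ∀ n : ℕ, n₀ ≤ n → injCount (SimpleGraph.cycleGraph k) (G n) = 0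

theorem adjMatrix_isHermitian_real {V : Type*} (G : SimpleGraph V) [DecidableRel G.Adj] :
    (G.adjMatrix ℝ).IsHermitian := by
  ext i j
  simp [Matrix.conjTranspose_apply, SimpleGraph.adjMatrix_apply, SimpleGraph.adj_comm]

/-- The eigenvalues of (the adjacency matrix of) the finite graph `G`, with multiplicity. -/
noncomputable def graphEigenvalues {V : Type*} [Fintype V] [DecidableEq V] (G : SimpleGraph V)
    [DecidableRel G.Adj] : V → ℝ :=
  (adjMatrix_isHermitian_real G).eigenvalues

/-- The uniform probability measure on the `v(G)` points `l / √d`, where `l` runs over the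
eigenvalues of `G` (with multiplicity). -/
noncomputable def rescaledSpectralMeasure {V : Type*} [Fintype V] [DecidableEq V] [Nonempty V]
    (G : SimpleGraph V) [DecidableRel G.Adj] (d : ℝ) : ProbabilityMeasure ℝ :=
  ⟨(Fintype.card V : ℝ≥0∞)⁻¹ • ∑ i : V, Measure.dirac (graphEigenvalues G i / Real.sqrt d), by
    constructor
    simp only [Measure.smul_apply, Measure.finsetSum_apply, measure_univ, Finset.sum_const,
      Finset.card_univ, nsmul_eq_mul, mul_one, smul_eq_mul]
    exact ENNReal.inv_mul_cancel (by simp) (by simp)⟩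

/-- Wigner's semicircle density on `[-2, 2]`. -/
noncomputable def semicircleDensity (x : ℝ) : ℝ := Real.sqrt (4 - x ^ 2) / (2 * Real.pi)

theorem semicircleDensity_continuous : Continuous semicircleDensity := by
  unfold semicircleDensity
  fun_prop

theorem integral_semicircleDensity : ∫ x in (-2 : ℝ)..2, semicircleDensity x = 1 := by
  have h := intervalIntegral.integral_comp_mul_left (a := -1) (b := 1) semicircleDensity
    (c := (2 : ℝ)) two_ne_zero
  have h2 : ∀ x : ℝ, semicircleDensity (2 * x) = Real.pi⁻¹ * Real.sqrt (1 - x ^ 2) := by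
    intro x
    have : (4 : ℝ) - (2 * x) ^ 2 = 2 ^ 2 * (1 - x ^ 2) := by ring
    rw [semicircleDensity, this, Real.sqrt_mul (by positivity), Real.sqrt_sq (by norm_num)]
    field_simp
  simp only [h2, intervalIntegral.integral_const_mul, integral_sqrt_one_sub_sq] at h
  norm_num at h
  have := Real.pi_ne_zero
  field_simp at h
  linarith

/-- The law on `ℝ` with density `semicircleDensity` on `[-2, 2]`. -/
noncomputable def standardSemicircle : ProbabilityMeasure ℝ :=
  ⟨(volume.restrict (Set.Icc (-2 : ℝ) 2)).withDensity
      (fun x => ENNReal.ofReal (semicircleDensity x)), by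
    constructor
    rw [withDensity_apply _ MeasurableSet.univ, Measure.restrict_univ,
      ← ofReal_integral_eq_lintegral_ofReal, integral_Icc_eq_integral_Ioc,
      ← intervalIntegral.integral_of_le (by norm_num), integral_semicircleDensity,
      ENNReal.ofReal_one]
    · exact semicircleDensity_continuous.continuousOn.integrableOn_Icc
    · exact Eventually.of_forall fun x => by unfold semicircleDensity; positivity⟩

/-- The semicircle distribution on `[-2 * β, 2 * β]`: the distribution of `β * X`, where `X` has
density `semicircleDensity` on `[-2, 2]`. -/
noncomputable def semicircleDistribution (β : ℝ) : ProbabilityMeasure ℝ :=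
  standardSemicircle.map (f := fun x => β * x) (by fun_prop)

/-! Let `A` be the adjacency matrix and `N_j` the matrix counting paths of length `j`. Without short
cycles, putting an edge in front of a path either extends it or backtracks along its first edge, so
`A N_{j+1} = N_{j+2} + D N_j` up to an error of at most `N_j`, with `D` the diagonal degree matrix.
After rescaling by `√d`, α-regularity lets `D / d` be replaced by `α` on average, and the normalized
traces of `A^p N_j` satisfy in the limit `t(p+1, j+1) = t(p, j+2) + α t(p, j)`, with `t(p+1, 0) =
t(p, 1)` and `t(0, j) = δ_{j0}` (`IsRegularSeq.tendsto_avgClosedWalks`).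

With `β = √α`, the semicircle integrals of `(βx)^p β^j U_j(x/2)` obey the same recursion: it is the
three-term recurrence of the Chebyshev polynomials `U_j`, which are orthogonal for the semicircle
density. The case `j = 0` is convergence of moments. Weak convergence follows by Taylor expansion of
characteristic functions (`tendsto_of_tendsto_moments`). -/

/-! ### Excluding short cycles -/

/-- `G` contains no cycle of length at most `K`. -/
def NoCycleUpTo {V : Type*} (G : SimpleGraph V) (K : ℕ) : Prop :=
  ∀ m : ℕ, 3 ≤ m → m ≤ K → injCount (SimpleGraph.cycleGraph m) G = 0

theorem NoCycleUpTo.mono {V : Type*} {G : SimpleGraph V} {K L : ℕ} (h : NoCycleUpTo G L)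
    (hKL : K ≤ L) : NoCycleUpTo G K := fun m h3 hm => h m h3 (hm.trans hKL)

theorem HasLargeGirth.eventually_noCycleUpTo {V : ℕ → Type u} {G : ∀ n, SimpleGraph (V n)}
    (h : HasLargeGirth G) (K : ℕ) : ∀ᶠ n in atTop, NoCycleUpTo (G n) K := by
  have h' : ∀ m ∈ Finset.Icc 3 K, ∀ᶠ n in atTop,
      injCount (SimpleGraph.cycleGraph m) (G n) = 0 := fun m hm =>
    let ⟨n₀, hn₀⟩ := h m (Finset.mem_Icc.1 hm).1
    eventually_atTop.2 ⟨n₀, hn₀⟩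
  filter_upwards [(Finset.eventually_all (Finset.Icc 3 K)).2 h'] with n hn m h3 hm
  exact hn m (Finset.mem_Icc.2 ⟨h3, hm⟩)

/-- If `w` sat at position `i ≥ 2` of the path, the edge from `u` to `w` would close its first `i`
steps into a cycle of length `i + 1 ≤ K`. -/
theorem NoCycleUpTo.eq_snd_of_mem_support {V : Type*} [Finite V] {G : SimpleGraph V} {K : ℕ} (hG : NoCycleUpTo G K) {u v w : V}
    {q : G.Walk u v} (hq : q.IsPath) (hlen : q.length + 1 ≤ K) (hadj : G.Adj u w)
    (hw : w ∈ q.support) : w = q.snd := by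
  obtain ⟨i, rfl, hi⟩ := SimpleGraph.Walk.mem_support_iff_exists_getVert.1 hw
  have hi0 : i ≠ 0 := by
    rintro rfl
    simp at hadj
  by_cases hi1 : i = 1
  · rw [hi1]
  exfalso
  have h0 := hG (i + 1) (by omega) (by omega)
  obtain h | h := Nat.card_eq_zero.1 h0
  · refine h.false ⟨⟨fun j : Fin (i + 1) => q.getVert j, ?_⟩, ?_⟩
    · have key : ∀ a b : Fin (i + 1), (a - b).val = 1 → G.Adj (q.getVert a) (q.getVert b) := by
        intro a b hab
        rcases le_or_gt b a with hle | hlt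
        · rw [Fin.sub_val_of_le hle] at hab
          have : (a : ℕ) = b + 1 := by omega
          rw [this]
          exact (q.adj_getVert_succ (by omega)).symm
        -- The subtraction in `Fin (i + 1)` wraps around, so this is the closing edge between
        -- positions `0` and `i`.
        · have h2 := Fin.coe_sub_iff_lt.2 hlt
          have ha : (a : ℕ) = 0 := by omega
          have hb : (b : ℕ) = i := by omega
          rw [ha, hb]
          simpa using hadj
      intro a b hab
      rcases SimpleGraph.cycleGraph_adj'.1 hab with h | h
      · exact key a b h
      · exact (key b a h).symm
    · intro a b hab
      have := hq.getVert_injOn (by simp; omega) (by simp; omega) hab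
      exact Fin.ext this
  -- `Nat.card` is also `0` on infinite types; finiteness of `V` excludes this.
  · have : Finite (SimpleGraph.cycleGraph (i + 1) →g G) := by
      exact Finite.of_injective (fun f => (f : Fin (i + 1) → V)) DFunLike.coe_injective
    exact h.not_finite inferInstance

/-! ### Counting paths and the backtracking recursion -/

section Paths

variable {V : Type*} [Fintype V] [DecidableEq V] (G : SimpleGraph V) [DecidableRel G.Adj]

/-- The finite set of paths of length `k` from `u` to `v`. -/
def pathFinset (k : ℕ) (u v : V) : Finset (G.Walk u v) :=
  {p ∈ G.finsetWalkLength k u v | p.IsPath}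

variable {G}

theorem mem_pathFinset {k : ℕ} {u v : V} {p : G.Walk u v} :
    p ∈ pathFinset G k u v ↔ p.length = k ∧ p.IsPath := by
  simp [pathFinset, SimpleGraph.mem_finsetWalkLength_iff]

theorem card_pathFinset_zero (u v : V) : (pathFinset G 0 u v).card = if u = v then 1 else 0 := by
  split_ifs with h
  · subst h
    rw [Finset.card_eq_one]
    refine ⟨SimpleGraph.Walk.nil, ?_⟩
    ext p
    rw [mem_pathFinset, Finset.mem_singleton]
    constructor
    · rintro ⟨h, -⟩
      exact SimpleGraph.Walk.eq_nil_iff_nil.2 (SimpleGraph.Walk.length_eq_zero_iff.1 h)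
    · rintro rfl
      simp
  · rw [Finset.card_eq_zero, Finset.eq_empty_iff_forall_notMem]
    intro p hp
    exact h (SimpleGraph.Walk.eq_of_length_eq_zero (mem_pathFinset.1 hp).1)

theorem card_pathFinset_succ_self (k : ℕ) (v : V) : (pathFinset G (k + 1) v v).card = 0 := by
  rw [Finset.card_eq_zero, Finset.eq_empty_iff_forall_notMem]
  intro p hp
  obtain ⟨hlen, hp⟩ := mem_pathFinset.1 hp
  rw [SimpleGraph.Walk.eq_nil_iff_nil.2 (SimpleGraph.Walk.isPath_iff_nil.1 hp)] at hlen
  simp at hlen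

theorem card_pathFinset_succ (k : ℕ) (u v : V) :
    (pathFinset G (k + 1) u v).card =
      ∑ w ∈ G.neighborFinset u, {p ∈ pathFinset G k w v | u ∉ p.support}.card := by
  rw [← Finset.card_sigma]
  symm
  refine Finset.card_bij (fun x hx => SimpleGraph.Walk.cons
    ((G.mem_neighborFinset u x.1).1 (Finset.mem_sigma.1 hx).1) x.2) ?_ ?_ ?_
  · rintro ⟨w, p⟩ hx
    simp only [Finset.mem_sigma, Finset.mem_filter, mem_pathFinset] at hx
    simp [mem_pathFinset, SimpleGraph.Walk.cons_isPath_iff, hx]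
  · rintro ⟨w, p⟩ hx ⟨w', p'⟩ hx' h
    simp only [SimpleGraph.Walk.cons.injEq] at h
    obtain ⟨rfl, h⟩ := h
    simpa using h
  · intro p hp
    obtain ⟨hlen, hp⟩ := mem_pathFinset.1 hp
    cases p with
    | nil => simp at hlen
    | @cons _ w _ h q =>
      rw [SimpleGraph.Walk.cons_isPath_iff] at hp
      refine ⟨⟨w, q⟩, ?_, rfl⟩
      simp only [Finset.mem_sigma, Finset.mem_filter, mem_pathFinset]
      simp at hlen
      simp [h, hp, hlen]

/-- A path from `w` that meets the neighbour `u` must visit it right after `w`, so deleting the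
first edge is a bijection. -/
theorem NoCycleUpTo.card_filter_mem_support {k : ℕ} (hG : NoCycleUpTo G (k + 2)) {u w : V} (v : V)
    (h : G.Adj u w) :
    {p ∈ pathFinset G (k + 1) w v | u ∈ p.support}.card =
      {q ∈ pathFinset G k u v | w ∉ q.support}.card := by
  symm
  refine Finset.card_bij (fun q _ => SimpleGraph.Walk.cons h.symm q) ?_ ?_ ?_
  · intro q hq
    simp only [Finset.mem_filter, mem_pathFinset] at hq
    simp [mem_pathFinset, SimpleGraph.Walk.cons_isPath_iff, hq]
  · intro q _ q' _ h
    simpa using h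
  · intro p hp
    simp only [Finset.mem_filter, mem_pathFinset] at hp
    obtain ⟨⟨hlen, hpath⟩, hu⟩ := hp
    have hsnd := hG.eq_snd_of_mem_support hpath (by omega) h.symm hu
    cases p with
    | nil => simp at hlen
    | @cons _ x _ hx q =>
      simp only [SimpleGraph.Walk.snd_cons] at hsnd
      subst hsnd
      rw [SimpleGraph.Walk.cons_isPath_iff] at hpath
      simp only [SimpleGraph.Walk.length_cons, add_left_inj] at hlen
      exact ⟨q, by simp [mem_pathFinset, hlen, hpath], rfl⟩

theorem NoCycleUpTo.sum_card_pathFinset_succ {k : ℕ} (hG : NoCycleUpTo G (k + 2)) (u v : V) :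
    ∑ w ∈ G.neighborFinset u, (pathFinset G (k + 1) w v).card =
      (pathFinset G (k + 2) u v).card +
        ∑ q ∈ pathFinset G k u v, {w ∈ G.neighborFinset u | w ∉ q.support}.card := by
  rw [card_pathFinset_succ]
  simp_rw [Finset.card_filter (fun w => w ∉ _)]
  rw [Finset.sum_comm, ← Finset.sum_add_distrib]
  refine Finset.sum_congr rfl fun w hw => ?_
  rw [← Finset.card_filter, ← hG.card_filter_mem_support v ((G.mem_neighborFinset u w).1 hw)]
  have := Finset.card_filter_add_card_filter_not (s := pathFinset G (k + 1) w v)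
    (fun p => u ∈ p.support)
  omega

/-- Only the second vertex of `q` can be a neighbour of `u` on `q`, hence the loss of at most one.
-/
theorem NoCycleUpTo.degree_le_card_filter {k : ℕ} (hG : NoCycleUpTo G (k + 2)) {u v : V}
    {q : G.Walk u v} (hq : q ∈ pathFinset G k u v) :
    G.degree u ≤ {w ∈ G.neighborFinset u | w ∉ q.support}.card + 1 := by
  rw [mem_pathFinset] at hq
  rw [← G.card_neighborFinset_eq_degree,
    ← Finset.card_filter_add_card_filter_not (s := G.neighborFinset u) (fun w => w ∉ q.support)]
  refine Nat.add_le_add_left ?_ _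
  refine Finset.card_le_one.2 fun a ha b hb => ?_
  simp only [not_not, Finset.mem_filter, SimpleGraph.mem_neighborFinset] at ha hb
  rw [hG.eq_snd_of_mem_support hq.2 (by omega) ha.1 ha.2,
    hG.eq_snd_of_mem_support hq.2 (by omega) hb.1 hb.2]

/-- In a graph without short cycles, appending an edge to the front of a path gives a longer path
or backtracks. -/
theorem NoCycleUpTo.sum_card_pathFinset_le {k : ℕ} (hG : NoCycleUpTo G (k + 2)) (u v : V) :
    ∑ w ∈ G.neighborFinset u, (pathFinset G (k + 1) w v).card ≤
      (pathFinset G (k + 2) u v).card + G.degree u * (pathFinset G k u v).card := by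
  rw [hG.sum_card_pathFinset_succ, mul_comm, ← smul_eq_mul]
  refine Nat.add_le_add_left (Finset.sum_le_card_nsmul _ _ _ fun q _ => ?_) _
  rw [← G.card_neighborFinset_eq_degree]
  exact Finset.card_filter_le _ _

theorem NoCycleUpTo.le_sum_card_pathFinset {k : ℕ} (hG : NoCycleUpTo G (k + 2)) (u v : V) :
    (pathFinset G (k + 2) u v).card + G.degree u * (pathFinset G k u v).card ≤
      ∑ w ∈ G.neighborFinset u, (pathFinset G (k + 1) w v).card + (pathFinset G k u v).card := by
  have h := Finset.card_nsmul_le_sum (pathFinset G k u v)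
    (fun q => {w ∈ G.neighborFinset u | w ∉ q.support}.card + 1) (G.degree u)
    fun q hq => hG.degree_le_card_filter hq
  rw [Finset.sum_add_distrib, Finset.sum_const, smul_eq_mul, smul_eq_mul, mul_one, mul_comm] at h
  rw [hG.sum_card_pathFinset_succ]
  omega

end Paths

/-! ### Path matrices and normalized traces -/

section PathMatrix

variable {V : Type*} [Fintype V] [DecidableEq V] (G : SimpleGraph V) [DecidableRel G.Adj]

/-- The matrix whose entry at `(u, v)` is the number of paths of length `k` from `u` to `v`. -/
def pathMatrix (k : ℕ) : Matrix V V ℝ :=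
  Matrix.of fun u v => ((pathFinset G k u v).card : ℝ)

/-- The normalized trace of `A ^ p * N j`, where `A` is the adjacency matrix and `N j` counts
paths of length `j`. -/
noncomputable def avgClosedWalks (d : ℝ) (p j : ℕ) : ℝ :=
  (G.adjMatrix ℝ ^ p * pathMatrix G j).trace / (Fintype.card V * Real.sqrt d ^ (p + j))

theorem pathMatrix_nonneg (k : ℕ) (u v : V) : 0 ≤ pathMatrix G k u v := Nat.cast_nonneg _

theorem pathMatrix_zero : pathMatrix G 0 = 1 := by
  ext u v
  simp [pathMatrix, card_pathFinset_zero, Matrix.one_apply]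

theorem pathMatrix_succ_self (k : ℕ) (v : V) : pathMatrix G (k + 1) v v = 0 := by
  simp [pathMatrix, card_pathFinset_succ_self]

theorem pathMatrix_one : pathMatrix G 1 = G.adjMatrix ℝ := by
  ext u v
  rw [pathMatrix, Matrix.of_apply, card_pathFinset_succ, SimpleGraph.adjMatrix_apply]
  have h : ∀ w ∈ G.neighborFinset u,
      {p ∈ pathFinset G 0 w v | u ∉ p.support}.card = if w = v then 1 else 0 := by
    intro w hw
    rw [← card_pathFinset_zero (G := G), Finset.filter_true_of_mem]
    intro p hp
    rw [SimpleGraph.Walk.nil_iff_support_eq.1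
      (SimpleGraph.Walk.length_eq_zero_iff.1 (mem_pathFinset.1 hp).1), List.mem_singleton]
    exact ((G.mem_neighborFinset u w).1 hw).ne
  rw [Finset.sum_congr rfl h, Finset.sum_ite_eq']
  simp

theorem adjMatrix_pow_nonneg (p : ℕ) (u v : V) : 0 ≤ (G.adjMatrix ℝ ^ p) u v := by
  rw [SimpleGraph.adjMatrix_pow_apply_eq_card_walk]
  exact Nat.cast_nonneg _

theorem pathMatrix_le_adjMatrix_pow (k : ℕ) (u v : V) :
    pathMatrix G k u v ≤ (G.adjMatrix ℝ ^ k) u v := by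
  rw [SimpleGraph.adjMatrix_pow_apply_eq_card_walk, SimpleGraph.card_set_walk_length_eq]
  exact Nat.cast_le.2 (Finset.card_filter_le _ _)

variable {G}

theorem NoCycleUpTo.adjMatrix_mul_pathMatrix_le {k : ℕ} (hG : NoCycleUpTo G (k + 2)) (u v : V) :
    (G.adjMatrix ℝ * pathMatrix G (k + 1)) u v ≤
      pathMatrix G (k + 2) u v + G.degree u * pathMatrix G k u v := by
  rw [SimpleGraph.adjMatrix_mul_apply]
  simp only [pathMatrix, Matrix.of_apply]
  exact_mod_cast hG.sum_card_pathFinset_le u v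

theorem NoCycleUpTo.le_adjMatrix_mul_pathMatrix {k : ℕ} (hG : NoCycleUpTo G (k + 2)) (u v : V) :
    pathMatrix G (k + 2) u v + G.degree u * pathMatrix G k u v ≤
      (G.adjMatrix ℝ * pathMatrix G (k + 1)) u v + pathMatrix G k u v := by
  rw [SimpleGraph.adjMatrix_mul_apply]
  simp only [pathMatrix, Matrix.of_apply]
  exact_mod_cast hG.le_sum_card_pathFinset u v

/-- Each factor `A` absorbed into the path matrix yields at most two terms of the same scale, since
`d = (√d)^2`; this gives `2 ^ p`. The bound is uniform in `v`, so it can serve as a weight bound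
when degree deviations are averaged. -/
theorem NoCycleUpTo.pow_mul_pathMatrix_apply_self_le {K : ℕ} (hG : NoCycleUpTo G K) {d : ℝ}
    (hd : IsAdmissible G d) (p j : ℕ) (hK : p + j ≤ K) (v : V) :
    (G.adjMatrix ℝ ^ p * pathMatrix G j) v v ≤ 2 ^ p * Real.sqrt d ^ (p + j) := by
  have hs : 1 ≤ Real.sqrt d := Real.one_le_sqrt.2 hd.1
  have hs2 : Real.sqrt d ^ 2 = d := Real.sq_sqrt (by linarith [hd.1])
  induction p generalizing j with
  | zero =>
    cases j with
    | zero => simp [pathMatrix_zero]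
    | succ j => simp only [pow_zero, one_mul, pathMatrix_succ_self]; positivity
  | succ p ih =>
    cases j with
    | zero =>
      rw [pathMatrix_zero, mul_one, pow_succ]
      nth_rw 2 [← pathMatrix_one]
      refine (ih 1 (by omega)).trans ?_
      rw [add_zero]
      gcongr <;> norm_num
    | succ j =>
      have h1 := ih (j + 2) (by omega)
      have h2 := ih j (by omega)
      have h3 : (G.adjMatrix ℝ ^ (p + 1) * pathMatrix G (j + 1)) v v ≤
          (G.adjMatrix ℝ ^ p * pathMatrix G (j + 2)) v v +
            d * (G.adjMatrix ℝ ^ p * pathMatrix G j) v v := by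
        rw [pow_succ, Matrix.mul_assoc, Matrix.mul_apply, Matrix.mul_apply, Matrix.mul_apply,
          Finset.mul_sum, ← Finset.sum_add_distrib]
        refine Finset.sum_le_sum fun w _ => ?_
        have h4 := (hG.mono (K := j + 2) (by omega)).adjMatrix_mul_pathMatrix_le w v
        have h5 := mul_le_mul_of_nonneg_right (hd.2 w) (pathMatrix_nonneg G j w v)
        have h6 := mul_le_mul_of_nonneg_left (h4.trans (add_le_add_right h5 _))
          (adjMatrix_pow_nonneg G p v w)
        linarith
      have h7 := mul_le_mul_of_nonneg_left h2 (by linarith [hd.1] : (0 : ℝ) ≤ d)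
      refine (h3.trans (add_le_add h1 h7)).trans (le_of_eq ?_)
      rw [show p + 1 + (j + 1) = (p + j) + 2 by ring, show p + (j + 2) = (p + j) + 2 by ring,
        pow_add _ (p + j) 2, hs2]
      ring

/-- The average deviation comes from replacing degrees by `α * d`; the term `1 / d` pays for the one
neighbour lost in backtracking. -/
theorem NoCycleUpTo.abs_avgClosedWalks_sub_le [Nonempty V] {p j : ℕ}
    (hG : NoCycleUpTo G (p + j + 2)) {d : ℝ} (hd : IsAdmissible G d) (α : ℝ) :
    |avgClosedWalks G d (p + 1) (j + 1) -
        (avgClosedWalks G d p (j + 2) + α * avgClosedWalks G d p j)| ≤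
      2 ^ (p + j) * ((∑ w, |(G.degree w : ℝ) / d - α|) / Fintype.card V + 1 / d) := by
  have hd0 : 0 < d := by linarith [hd.1]
  set s := Real.sqrt d with hs
  have hs0 : 0 < s := Real.sqrt_pos.2 hd0
  have hs2 : s ^ 2 = d := Real.sq_sqrt hd0.le
  have hV : (0 : ℝ) < Fintype.card V := Nat.cast_pos.2 Fintype.card_pos
  have hpow : s ^ (p + j + 2) = s ^ (p + j) * d := by rw [pow_add, hs2]
  have hdiff : avgClosedWalks G d (p + 1) (j + 1) -
        (avgClosedWalks G d p (j + 2) + α * avgClosedWalks G d p j) =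
      (∑ v, ∑ w, (G.adjMatrix ℝ ^ p) v w * ((G.adjMatrix ℝ * pathMatrix G (j + 1)) w v -
        pathMatrix G (j + 2) w v - α * d * pathMatrix G j w v)) /
        (Fintype.card V * s ^ (p + j + 2)) := by
    have e : ∑ v, ∑ w, (G.adjMatrix ℝ ^ p) v w * ((G.adjMatrix ℝ * pathMatrix G (j + 1)) w v -
        pathMatrix G (j + 2) w v - α * d * pathMatrix G j w v) =
        (G.adjMatrix ℝ ^ (p + 1) * pathMatrix G (j + 1)).trace -
        (G.adjMatrix ℝ ^ p * pathMatrix G (j + 2)).trace -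
        α * d * (G.adjMatrix ℝ ^ p * pathMatrix G j).trace := by
      rw [pow_succ, Matrix.mul_assoc]
      simp only [Matrix.trace, Matrix.diag_apply]
      rw [Finset.mul_sum, ← Finset.sum_sub_distrib, ← Finset.sum_sub_distrib]
      refine Finset.sum_congr rfl fun v _ => ?_
      rw [Matrix.mul_apply, Matrix.mul_apply (N := pathMatrix G (j + 2)),
        Matrix.mul_apply (N := pathMatrix G j),
        Finset.mul_sum, ← Finset.sum_sub_distrib, ← Finset.sum_sub_distrib]
      exact Finset.sum_congr rfl fun w _ => by ring
    rw [e, avgClosedWalks, avgClosedWalks, avgClosedWalks, ← hs,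
      show p + 1 + (j + 1) = p + j + 2 by ring, ← add_assoc p j 2, hpow]
    field_simp
    ring
  -- The sum is a diagonal entry of `N_j A^p`, which is dominated by that of `A^(p+j)` because paths
  -- are walks.
  have hdiag : ∀ w, ∑ v, (G.adjMatrix ℝ ^ p) v w * pathMatrix G j w v ≤
      2 ^ (p + j) * s ^ (p + j) := by
    intro w
    have h := (hG.mono (K := p + j) (by omega)).pow_mul_pathMatrix_apply_self_le hd (p + j) 0
      (by omega) w
    rw [pathMatrix_zero, mul_one, add_comm p j, pow_add, Matrix.mul_apply] at h
    rw [add_comm p j]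
    refine le_trans (Finset.sum_le_sum fun v _ => ?_) h
    rw [mul_comm]
    exact mul_le_mul_of_nonneg_right (pathMatrix_le_adjMatrix_pow G j w v)
      (adjMatrix_pow_nonneg G p v w)
  have hnum : |∑ v, ∑ w, (G.adjMatrix ℝ ^ p) v w * ((G.adjMatrix ℝ * pathMatrix G (j + 1)) w v -
        pathMatrix G (j + 2) w v - α * d * pathMatrix G j w v)| ≤
      ∑ w, (d * |(G.degree w : ℝ) / d - α| + 1) * (2 ^ (p + j) * s ^ (p + j)) := by
    -- With `w` outermost, its degree deviation factors out of the inner sum, which `hdiag` bounds.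
    rw [Finset.sum_comm]
    refine (Finset.abs_sum_le_sum_abs _ _).trans (Finset.sum_le_sum fun w _ => ?_)
    refine le_trans ?_ (mul_le_mul_of_nonneg_left (hdiag w) (by positivity))
    rw [Finset.mul_sum]
    refine (Finset.abs_sum_le_sum_abs _ _).trans (Finset.sum_le_sum fun v _ => ?_)
    have hA := adjMatrix_pow_nonneg G p v w
    have hN := pathMatrix_nonneg G j w v
    rw [abs_mul, abs_of_nonneg hA, mul_left_comm]
    refine mul_le_mul_of_nonneg_left ?_ hA
    have hG' := hG.mono (K := j + 2) (by omega)
    have h1 := hG'.adjMatrix_mul_pathMatrix_le w v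
    have h2 := hG'.le_adjMatrix_mul_pathMatrix w v
    have h3 : d * |(G.degree w : ℝ) / d - α| = |(G.degree w : ℝ) - α * d| := by
      rw [← abs_of_pos hd0, ← abs_mul, abs_of_pos hd0]
      congr 1
      field_simp
    rw [h3]
    have h4 := mul_le_mul_of_nonneg_right (le_abs_self ((G.degree w : ℝ) - α * d)) hN
    have h5 := mul_le_mul_of_nonneg_right (neg_abs_le ((G.degree w : ℝ) - α * d)) hN
    rw [abs_le]
    constructor <;> nlinarith
  rw [hdiff, abs_div, abs_of_pos (a := Fintype.card V * s ^ (p + j + 2)) (by positivity),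
    div_le_iff₀ (by positivity)]
  refine hnum.trans (le_of_eq ?_)
  rw [← Finset.sum_mul, Finset.sum_add_distrib, ← Finset.mul_sum, Finset.sum_const,
    Finset.card_univ, nsmul_eq_mul, mul_one, hpow]
  field_simp

end PathMatrix

/-! ### Passing to the limit in the recursion -/

/-- For functions bounded by `1` this turns convergence in probability into convergence in mean. -/
theorem sum_div_card_le_add_uniformProb {V : Type*} [Fintype V] [Nonempty V] (f : V → ℝ)
    (hf : ∀ v, f v ≤ 1) {ε : ℝ} (hε : 0 < ε) :
    (∑ v, f v) / Fintype.card V ≤ ε + uniformProb V (fun v => ε ≤ f v) := by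
  classical
  have hV : (0 : ℝ) < Fintype.card V := Nat.cast_pos.2 Fintype.card_pos
  rw [uniformProb, Nat.card_eq_fintype_card, Fintype.card_subtype, div_le_iff₀ hV, add_mul,
    div_mul_cancel₀ _ hV.ne', Finset.card_filter, Nat.cast_sum]
  have h : ∑ v, f v ≤ ∑ v, (ε + ((if ε ≤ f v then 1 else 0 : ℕ) : ℝ)) := by
    refine Finset.sum_le_sum fun v _ => ?_
    split_ifs with h
    · have := hf v
      push_cast
      linarith
    · push_cast
      linarith
  rw [Finset.sum_add_distrib, Finset.sum_const, Finset.card_univ, nsmul_eq_mul] at h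
  linarith

section Limits

variable {V : ℕ → Type u} [∀ n, Fintype (V n)] {G : ∀ n, SimpleGraph (V n)}
  [∀ n, DecidableRel (G n).Adj] {d : ℕ → ℝ} {α : ℝ}

theorem IsRegularSeq.tendsto_avg_abs_degree_sub [∀ n, Nonempty (V n)]
    (hreg : IsRegularSeq G d α) :
    Tendsto (fun n => (∑ w, |((G n).degree w : ℝ) / d n - α|) / Fintype.card (V n)) atTop
      (𝓝 0) := by
  rw [Metric.tendsto_atTop]
  intro ε hε
  obtain ⟨N, hN⟩ := Metric.tendsto_atTop.1 (hreg.tendsto_prob (ε / 2) (by positivity)) (ε / 2)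
    (by positivity)
  refine ⟨N, fun n hn => ?_⟩
  have h1 := hN n hn
  rw [Real.dist_0_eq_abs] at h1 ⊢
  have h2 := (abs_lt.1 h1).2
  rw [abs_of_nonneg (by positivity)]
  have hd0 : 0 < d n := by linarith [(hreg.admissible n).1]
  have h3 := sum_div_card_le_add_uniformProb (fun w => |((G n).degree w : ℝ) / d n - α|)
    (fun v => by
      have h4 : ((G n).degree v : ℝ) / d n ≤ 1 :=
        (div_le_one hd0).2 ((hreg.admissible n).2 v)
      have h5 : 0 ≤ ((G n).degree v : ℝ) / d n := by positivity
      rw [abs_le]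
      constructor <;> linarith [hreg.nonneg, hreg.le_one]) (half_pos hε)
  linarith

/-- The three conditions determine `t` by induction on `p`, so any solution of the recursion gives
the limits. -/
theorem IsRegularSeq.tendsto_avgClosedWalks [∀ n, DecidableEq (V n)] [∀ n, Nonempty (V n)]
    (hreg : IsRegularSeq G d α) (hgirth : HasLargeGirth G) (hd : Tendsto d atTop atTop)
    {t : ℕ → ℕ → ℝ} (h0 : ∀ j, t 0 j = if j = 0 then 1 else 0) (h1 : ∀ p, t (p + 1) 0 = t p 1)
    (h2 : ∀ p j, t (p + 1) (j + 1) = t p (j + 2) + α * t p j) (p j : ℕ) :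
    Tendsto (fun n => avgClosedWalks (G n) (d n) p j) atTop (𝓝 (t p j)) := by
  induction p generalizing j with
  | zero =>
    rw [h0]
    refine tendsto_const_nhds.congr fun n => ?_
    cases j with
    | zero => simp [avgClosedWalks, pathMatrix_zero, Matrix.trace_one]
    | succ j => simp [avgClosedWalks, Matrix.trace, pathMatrix_succ_self]
  | succ p ih =>
    cases j with
    | zero =>
      rw [h1]
      refine (ih 1).congr fun n => ?_
      rw [avgClosedWalks, avgClosedWalks, pathMatrix_zero, pathMatrix_one, mul_one, ← pow_succ,
        add_zero]
    | succ j =>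
      rw [h2]
      have herr : Tendsto (fun n => avgClosedWalks (G n) (d n) (p + 1) (j + 1) -
          (avgClosedWalks (G n) (d n) p (j + 2) + α * avgClosedWalks (G n) (d n) p j)) atTop
          (𝓝 0) := by
        have hb : Tendsto (fun n => 2 ^ (p + j) *
            ((∑ w, |((G n).degree w : ℝ) / d n - α|) / Fintype.card (V n) + 1 / d n)) atTop
            (𝓝 0) := by
          have := (hreg.tendsto_avg_abs_degree_sub.add
            (tendsto_const_nhds.div_atTop hd : Tendsto (fun n => (1 : ℝ) / d n) atTop _)).const_mul
            ((2 : ℝ) ^ (p + j))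
          simpa using this
        refine squeeze_zero_norm' ?_ hb
        filter_upwards [hgirth.eventually_noCycleUpTo (p + j + 2)] with n hn
        exact hn.abs_avgClosedWalks_sub_le (hreg.admissible n) α
      have := herr.add ((ih (j + 2)).add ((ih j).const_mul α))
      simpa using this

end Limits

/-! ### Chebyshev polynomials and the semicircle law -/

-- Substituting `x = 2 cos θ` and using `U_j(cos θ) sin θ = sin((j+1)θ)` turns the integrand into a
-- difference of cosines of nonzero integer frequencies when `j ≠ 0`.
open Polynomial.Chebyshev in
theorem integral_U_mul_semicircleDensity (j : ℕ) :
    ∫ x in (-2 : ℝ)..2, (U ℝ j).eval (x / 2) * semicircleDensity x = if j = 0 then 1 else 0 := by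
  split_ifs with hj
  · subst hj
    simpa using integral_semicircleDensity
  have hcont : Continuous fun x : ℝ => (U ℝ j).eval (x / 2) * semicircleDensity x :=
    ((U ℝ j).continuous.comp (by fun_prop)).mul semicircleDensity_continuous
  have h := intervalIntegral.integral_comp_mul_deriv (a := 0) (b := Real.pi)
    (f := fun θ => 2 * Real.cos θ) (f' := fun θ => 2 * -Real.sin θ)
    (fun θ _ => (Real.hasDerivAt_cos θ).const_mul 2) (by fun_prop) hcont
  have hint : ∀ k : ℕ, k ≠ 0 → ∫ θ in (0 : ℝ)..Real.pi, Real.cos (k * θ) = 0 := by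
    intro k hk
    rw [intervalIntegral.integral_comp_mul_left _ (Nat.cast_ne_zero.2 hk), integral_cos]
    simp [Real.sin_nat_mul_pi]
  have hval : Set.EqOn ((fun θ => ((fun x : ℝ => (U ℝ j).eval (x / 2) * semicircleDensity x) ∘
      fun θ => 2 * Real.cos θ) θ * (2 * -Real.sin θ)))
      (fun θ => Real.pi⁻¹ * (Real.cos ((j + 2 : ℕ) * θ) - Real.cos (j * θ)))
      (Set.uIcc 0 Real.pi) := by
    intro θ hθ
    rw [Set.uIcc_of_le Real.pi_pos.le] at hθ
    have hsin : 0 ≤ Real.sin θ := Real.sin_nonneg_of_nonneg_of_le_pi hθ.1 hθ.2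
    have hsq : Real.sqrt (4 - (2 * Real.cos θ) ^ 2) = 2 * Real.sin θ := by
      rw [show 4 - (2 * Real.cos θ) ^ 2 = (2 * Real.sin θ) ^ 2 by
        nlinarith [Real.sin_sq_add_cos_sq θ], Real.sqrt_sq (by positivity)]
    have hU := U_real_cos θ (j : ℤ)
    have hcos : Real.cos ((j + 2 : ℕ) * θ) - Real.cos (j * θ) =
        -2 * Real.sin ((j + 1) * θ) * Real.sin θ := by
      rw [show ((j + 2 : ℕ) : ℝ) * θ = (j + 1) * θ + θ by push_cast; ring,
        show (j : ℝ) * θ = (j + 1) * θ - θ by ring, Real.cos_add, Real.cos_sub]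
      ring
    simp only [Function.comp_apply, semicircleDensity, hsq, hcos,
      mul_div_cancel_left₀ (Real.cos θ) two_ne_zero]
    push_cast at hU
    rw [← hU]
    field_simp
  rw [intervalIntegral.integral_congr hval, intervalIntegral.integral_const_mul,
    intervalIntegral.integral_sub (Continuous.intervalIntegrable (by fun_prop) _ _)
      (Continuous.intervalIntegrable (by fun_prop) _ _), hint _ (by omega), hint _ hj] at h
  simp only [Real.cos_zero, Real.cos_pi] at h
  -- The substitution runs from `2` down to `-2`, so the orientation is reversed.
  rw [intervalIntegral.integral_symm]
  norm_num at h ⊢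
  exact h.symm

/-- The integral of `(β x) ^ p` against the rescaled Chebyshev polynomial `β ^ j * U_j (x / 2)`
and the semicircle density. -/
noncomputable def semicircleChebyshevMoment (β : ℝ) (p j : ℕ) : ℝ :=
  ∫ x in (-2 : ℝ)..2, (β * x) ^ p * (β ^ j * (Polynomial.Chebyshev.U ℝ j).eval (x / 2)) *
    semicircleDensity x

theorem semicircleChebyshevMoment_zero_right (β : ℝ) (p : ℕ) :
    semicircleChebyshevMoment β p 0 = ∫ x in (-2 : ℝ)..2, (β * x) ^ p * semicircleDensity x := by
  simp [semicircleChebyshevMoment]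

theorem semicircleChebyshevMoment_zero_left (β : ℝ) (j : ℕ) :
    semicircleChebyshevMoment β 0 j = if j = 0 then 1 else 0 := by
  have h := integral_U_mul_semicircleDensity j
  simp only [semicircleChebyshevMoment, pow_zero, one_mul, mul_assoc]
  rw [intervalIntegral.integral_const_mul, h]
  split_ifs with hj <;> simp [hj]

theorem semicircleChebyshevMoment_succ_zero (β : ℝ) (p : ℕ) :
    semicircleChebyshevMoment β (p + 1) 0 = semicircleChebyshevMoment β p 1 := by
  unfold semicircleChebyshevMoment
  congr 1
  ext x
  simp [pow_succ, mul_div_cancel₀]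

/-- This is `x U_{j+1}(x/2) = U_{j+2}(x/2) + U_j(x/2)`, multiplied by `β ^ (j + 2)` and integrated.
-/
theorem semicircleChebyshevMoment_succ_succ (β : ℝ) (p j : ℕ) :
    semicircleChebyshevMoment β (p + 1) (j + 1) =
      semicircleChebyshevMoment β p (j + 2) + β ^ 2 * semicircleChebyshevMoment β p j := by
  have hcont : ∀ j : ℕ, Continuous fun x : ℝ => (β * x) ^ p *
      (β ^ j * (Polynomial.Chebyshev.U ℝ j).eval (x / 2)) * semicircleDensity x := fun j =>
    ((by fun_prop : Continuous fun x : ℝ => (β * x) ^ p).mul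
      (continuous_const.mul ((Polynomial.Chebyshev.U ℝ j).continuous.comp (by fun_prop)))).mul
      semicircleDensity_continuous
  unfold semicircleChebyshevMoment
  rw [← intervalIntegral.integral_const_mul, ← intervalIntegral.integral_add
    ((hcont _).intervalIntegrable _ _) (((hcont _).const_mul _).intervalIntegrable _ _)]
  congr 1
  ext x
  have h := Polynomial.Chebyshev.U_add_two ℝ (j : ℤ)
  push_cast
  rw [h]
  simp
  ring

theorem integral_standardSemicircle (f : ℝ → ℝ) :
    ∫ x, f x ∂(standardSemicircle : Measure ℝ) =
      ∫ x in (-2 : ℝ)..2, f x * semicircleDensity x := by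
  have hnn : ∀ x, 0 ≤ semicircleDensity x := fun x => by unfold semicircleDensity; positivity
  change ∫ x, f x ∂((volume.restrict (Set.Icc (-2 : ℝ) 2)).withDensity
      (fun x => ENNReal.ofReal (semicircleDensity x))) = _
  rw [integral_withDensity_eq_integral_toReal_smul
    semicircleDensity_continuous.measurable.ennreal_ofReal (by simp),
    integral_Icc_eq_integral_Ioc, ← intervalIntegral.integral_of_le (by norm_num)]
  simp [ENNReal.toReal_ofReal (hnn _), mul_comm]

theorem integral_pow_semicircleDistribution (β : ℝ) (k : ℕ) :
    ∫ x, x ^ k ∂(semicircleDistribution β : Measure ℝ) =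
      ∫ x in (-2 : ℝ)..2, (β * x) ^ k * semicircleDensity x := by
  rw [semicircleDistribution, ProbabilityMeasure.toMeasure_map,
    integral_map (by fun_prop) (by fun_prop), integral_standardSemicircle]

theorem integrable_pow_semicircleDistribution (β : ℝ) (k : ℕ) :
    Integrable (fun x => x ^ k) (semicircleDistribution β : Measure ℝ) := by
  rw [semicircleDistribution, ProbabilityMeasure.toMeasure_map,
    integrable_map_measure (by fun_prop) (by fun_prop)]
  change Integrable _ ((volume.restrict (Set.Icc (-2 : ℝ) 2)).withDensity
      (fun x => ENNReal.ofReal (semicircleDensity x)))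
  rw [integrable_withDensity_iff_integrable_smul'
    semicircleDensity_continuous.measurable.ennreal_ofReal (by simp)]
  refine Continuous.integrableOn_Icc ?_
  have hnn : ∀ x, 0 ≤ semicircleDensity x := fun x => by unfold semicircleDensity; positivity
  simp only [ENNReal.toReal_ofReal (hnn _)]
  exact semicircleDensity_continuous.smul (by fun_prop)

theorem integral_pow_semicircleDistribution_le {β : ℝ} (h0 : 0 ≤ β) (h1 : β ≤ 1) (k : ℕ) :
    ∫ x, x ^ k ∂(semicircleDistribution β : Measure ℝ) ≤ 2 ^ k := by
  have hnn : ∀ x, 0 ≤ semicircleDensity x := fun x => by unfold semicircleDensity; positivity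
  rw [integral_pow_semicircleDistribution, ← mul_one ((2 : ℝ) ^ k), ← integral_semicircleDensity,
    ← intervalIntegral.integral_const_mul]
  refine intervalIntegral.integral_mono_on (by norm_num)
    (((by fun_prop : Continuous fun x : ℝ => (β * x) ^ k).mul
      semicircleDensity_continuous).intervalIntegrable _ _)
    ((semicircleDensity_continuous.const_mul _).intervalIntegrable _ _) fun x hx => ?_
  refine mul_le_mul_of_nonneg_right ?_ (hnn x)
  refine (le_abs_self _).trans ?_
  rw [abs_pow, abs_mul, abs_of_nonneg h0]
  refine pow_le_pow_left₀ (by positivity) ?_ k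
  have : |x| ≤ 2 := abs_le.2 hx
  nlinarith [abs_nonneg x]

/-! ### The method of moments -/

/-- The derivative of each Taylor remainder is `c` times the preceding one, so the bound integrates
up. A general `c` allows `-I`, which covers negative arguments. -/
theorem Complex.norm_exp_mul_sub_sum_le_of_nonneg {c : ℂ} (hc : c.re = 0) (hc1 : ‖c‖ ≤ 1) (n : ℕ)
    {x : ℝ} (hx : 0 ≤ x) :
    ‖Complex.exp (c * x) - ∑ j ∈ Finset.range n, (c * x) ^ j / (j.factorial : ℂ)‖ ≤
      x ^ n / n.factorial := by
  induction n generalizing x with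
  | zero => simp [Complex.norm_exp, hc]
  | succ n ih =>
    have hderiv : ∀ y : ℝ, HasDerivAt (fun y : ℝ => Complex.exp (c * y) -
        ∑ j ∈ Finset.range (n + 1), (c * y) ^ j / (j.factorial : ℂ))
        (c * (Complex.exp (c * y) - ∑ j ∈ Finset.range n, (c * y) ^ j / (j.factorial : ℂ))) y := by
      intro y
      have hlin : HasDerivAt (fun y : ℝ => c * (y : ℂ)) c y := by
        simpa using (Complex.ofRealCLM.hasDerivAt (x := y)).const_mul c
      have hsum : HasDerivAt (fun y : ℝ =>
          ∑ j ∈ Finset.range (n + 1), (c * y) ^ j / (j.factorial : ℂ))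
          (c * ∑ j ∈ Finset.range n, (c * y) ^ j / (j.factorial : ℂ)) y := by
        have hterm : ∀ j ∈ Finset.range n, HasDerivAt
            (fun y : ℝ => (c * y) ^ (j + 1) / ((j + 1).factorial : ℂ))
            (c * ((c * y) ^ j / (j.factorial : ℂ))) y := by
          intro j _
          refine ((hlin.fun_pow (j + 1)).div_const ((j + 1).factorial : ℂ)).congr_deriv ?_
          rw [Nat.factorial_succ]
          have : ((j.factorial : ℕ) : ℂ) ≠ 0 := Nat.cast_ne_zero.2 j.factorial_ne_zero
          have : ((j : ℂ) + 1) ≠ 0 := Nat.cast_add_one_ne_zero j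
          push_cast
          field_simp
        simp_rw [Finset.sum_range_succ' _ n, pow_zero, Finset.mul_sum]
        exact (HasDerivAt.fun_sum hterm).add_const _
      rw [mul_sub, mul_comm c (Complex.exp _)]
      exact hlin.cexp.sub hsum
    have hB : ∀ y : ℝ, HasDerivAt (fun y : ℝ => y ^ (n + 1) / ((n + 1).factorial : ℝ))
        (y ^ n / n.factorial) y := by
      intro y
      refine ((hasDerivAt_pow (n + 1) y).div_const ((n + 1).factorial : ℝ)).congr_deriv ?_
      rw [Nat.factorial_succ]
      push_cast
      field_simp
    refine image_norm_le_of_norm_deriv_right_le_deriv_boundary (a := 0) (b := x)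
      (fun y _ => (hderiv y).continuousAt.continuousWithinAt)
      (fun y _ => (hderiv y).hasDerivWithinAt) ?_
      (fun y => hB y) ?_ ⟨hx, le_rfl⟩
    · simp [Finset.sum_range_succ']
    · intro y hy
      rw [norm_mul]
      exact (mul_le_of_le_one_left (norm_nonneg _) hc1).trans (ih hy.1)

theorem Complex.norm_exp_mul_I_sub_sum_le (n : ℕ) (x : ℝ) :
    ‖Complex.exp (x * Complex.I) -
      ∑ j ∈ Finset.range n, (x * Complex.I) ^ j / (j.factorial : ℂ)‖ ≤ |x| ^ n / n.factorial := by
  rcases le_total 0 x with hx | hx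
  · rw [abs_of_nonneg hx, mul_comm]
    exact Complex.norm_exp_mul_sub_sum_le_of_nonneg (c := Complex.I) (by simp) (by simp) n hx
  · have h := Complex.norm_exp_mul_sub_sum_le_of_nonneg (c := -Complex.I) (by simp) (by simp) n
      (neg_nonneg.2 hx)
    rw [abs_of_nonpos hx]
    convert h using 4 <;> simp [mul_comm]

theorem norm_charFun_sub_sum_moments_le (μ : ProbabilityMeasure ℝ)
    (hint : ∀ k : ℕ, Integrable (fun x : ℝ => x ^ k) (μ : Measure ℝ)) (t : ℝ) (r : ℕ) :
    ‖charFun (μ : Measure ℝ) t - ∑ j ∈ Finset.range (2 * r),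
      (t * Complex.I) ^ j / (j.factorial : ℂ) * ((∫ x, x ^ j ∂(μ : Measure ℝ) : ℝ) : ℂ)‖ ≤
      t ^ (2 * r) / (2 * r).factorial * ∫ x, x ^ (2 * r) ∂(μ : Measure ℝ) := by
  have hintC : ∀ k : ℕ, Integrable (fun x : ℝ => ((x ^ k : ℝ) : ℂ)) (μ : Measure ℝ) :=
    fun k => (hint k).ofReal
  have hexp : Integrable (fun x : ℝ => Complex.exp (t * x * Complex.I)) (μ : Measure ℝ) := by
    refine Integrable.of_bound (C := 1) (by fun_prop) (Eventually.of_forall fun x => ?_)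
    rw [← Complex.ofReal_mul, Complex.norm_exp_ofReal_mul_I]
  have hterm : ∀ j ∈ Finset.range (2 * r), Integrable (fun x : ℝ =>
      (t * Complex.I) ^ j / (j.factorial : ℂ) * ((x ^ j : ℝ) : ℂ)) (μ : Measure ℝ) :=
    fun j _ => (hintC j).const_mul _
  have hsum : ∑ j ∈ Finset.range (2 * r), (t * Complex.I) ^ j / (j.factorial : ℂ) *
      ((∫ x, x ^ j ∂(μ : Measure ℝ) : ℝ) : ℂ) =
      ∫ x, ∑ j ∈ Finset.range (2 * r), (t * Complex.I) ^ j / (j.factorial : ℂ) *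
        ((x ^ j : ℝ) : ℂ) ∂(μ : Measure ℝ) := by
    rw [integral_finsetSum _ hterm]
    refine Finset.sum_congr rfl fun j _ => ?_
    rw [integral_const_mul, integral_complex_ofReal]
  rw [charFun_apply_real, hsum, ← integral_sub hexp (integrable_finsetSum _ hterm),
    ← integral_const_mul]
  refine norm_integral_le_of_norm_le ((hint _).const_mul _) (Eventually.of_forall fun x => ?_)
  have h := Complex.norm_exp_mul_I_sub_sum_le (2 * r) (t * x)
  -- The even order removes the absolute value, so the remainder is controlled by an ordinary
  -- moment.
  rw [(even_two_mul r).pow_abs, mul_pow] at h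
  convert h using 1
  · congr 2
    · push_cast
      ring_nf
    · refine Finset.sum_congr rfl fun j _ => ?_
      push_cast
      ring
  · ring

/-- The method of moments, for a limit measure whose moments grow at most exponentially. -/
theorem tendsto_of_tendsto_moments {μ : ℕ → ProbabilityMeasure ℝ} {ν : ProbabilityMeasure ℝ}
    (hμ : ∀ n, ∀ k : ℕ, Integrable (fun x : ℝ => x ^ k) (μ n : Measure ℝ))
    (hν : ∀ k : ℕ, Integrable (fun x : ℝ => x ^ k) (ν : Measure ℝ)) {C : ℝ}
    (hC : ∀ k : ℕ, ∫ x, x ^ k ∂(ν : Measure ℝ) ≤ C ^ k)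
    (h : ∀ k : ℕ, Tendsto (fun n => ∫ x, x ^ k ∂(μ n : Measure ℝ)) atTop
      (𝓝 (∫ x, x ^ k ∂(ν : Measure ℝ)))) :
    Tendsto μ atTop (𝓝 ν) := by
  rw [ProbabilityMeasure.tendsto_iff_tendsto_charFun]
  intro t
  rw [Metric.tendsto_nhds]
  intro ε hε
  -- The order `r` depends only on the limit measure; convergence of the moment of order `2 * r`
  -- then carries the remainder bound over to `μ n` for large `n`.
  obtain ⟨r, hr⟩ : ∃ r : ℕ, t ^ (2 * r) / (2 * r).factorial * C ^ (2 * r) < ε / 3 := by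
    have h1 := (FloorSemiring.tendsto_pow_div_factorial_atTop (t * C)).comp
      (tendsto_id.const_mul_atTop' (two_pos : 0 < 2))
    obtain ⟨r, hr⟩ := (h1.eventually (gt_mem_nhds (by positivity : 0 < ε / 3))).exists
    refine ⟨r, lt_of_le_of_lt (le_of_eq ?_) hr⟩
    simp only [Function.comp_apply, id, mul_pow]
    ring
  set S : ProbabilityMeasure ℝ → ℂ := fun ρ => ∑ j ∈ Finset.range (2 * r),
      (t * Complex.I) ^ j / (j.factorial : ℂ) * ((∫ x, x ^ j ∂(ρ : Measure ℝ) : ℝ) : ℂ) with hS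
  have hSlim : Tendsto (fun n => S (μ n)) atTop (𝓝 (S ν)) :=
    tendsto_finsetSum _ fun j _ =>
      ((Complex.continuous_ofReal.tendsto _).comp (h j)).const_mul _
  have hc : 0 ≤ t ^ (2 * r) / (2 * r).factorial :=
    div_nonneg ((even_two_mul r).pow_nonneg t) (Nat.cast_nonneg _)
  have hνr : t ^ (2 * r) / (2 * r).factorial * ∫ x, x ^ (2 * r) ∂(ν : Measure ℝ) < ε / 3 :=
    (mul_le_mul_of_nonneg_left (hC _) hc).trans_lt hr
  filter_upwards [Metric.tendsto_nhds.1 hSlim (ε / 3) (by positivity),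
    ((h (2 * r)).const_mul _).eventually (gt_mem_nhds hνr)] with n hn1 hn2
  have e1 := norm_charFun_sub_sum_moments_le (μ n) (hμ n) t r
  have e2 := norm_charFun_sub_sum_moments_le ν hν t r
  rw [dist_eq_norm] at hn1 ⊢
  calc ‖charFun (μ n : Measure ℝ) t - charFun (ν : Measure ℝ) t‖
      = ‖(charFun (μ n : Measure ℝ) t - S (μ n)) + (S (μ n) - S ν) -
          (charFun (ν : Measure ℝ) t - S ν)‖ := by congr 1; ring
    _ ≤ ‖charFun (μ n : Measure ℝ) t - S (μ n)‖ + ‖S (μ n) - S ν‖ +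
          ‖charFun (ν : Measure ℝ) t - S ν‖ :=
        (norm_sub_le _ _).trans (add_le_add_left (norm_add_le _ _) _)
    _ < ε := by linarith

/-! ### Spectral measures: moments and support -/

theorem Matrix.IsHermitian.sum_eigenvalues_pow {V : Type*} [Fintype V] [DecidableEq V]
    {A : Matrix V V ℝ} (hA : A.IsHermitian) (k : ℕ) :
    ∑ i, hA.eigenvalues i ^ k = (A ^ k).trace := by
  conv_rhs => rw [hA.spectral_theorem, ← map_pow, Matrix.diagonal_pow]
  rw [Unitary.conjStarAlgAut_apply, Matrix.trace_mul_cycle, Unitary.coe_star_mul_self, one_mul,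
    Matrix.trace_diagonal]
  simp

section SpectralMeasure

variable {V : Type*} [Fintype V] [DecidableEq V] (G : SimpleGraph V) [DecidableRel G.Adj]

variable {G} in
theorem IsAdmissible.abs_graphEigenvalues_le {d : ℝ} (hd : IsAdmissible G d) (i : V) :
    |graphEigenvalues G i| ≤ d := by
  have hmem : Module.End.HasEigenvalue (Matrix.toLin' (G.adjMatrix ℝ)) (graphEigenvalues G i) := by
    rw [Module.End.hasEigenvalue_iff_mem_spectrum, Matrix.spectrum_toLin']
    exact (adjMatrix_isHermitian_real G).eigenvalues_mem_spectrum_real i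
  -- Gershgorin: the discs are centred at the zero diagonal entries and their radii are the degrees.
  obtain ⟨k, hk⟩ := eigenvalue_mem_ball hmem
  rw [SimpleGraph.adjMatrix_apply, if_neg (G.irrefl), mem_closedBall_zero_iff,
    Real.norm_eq_abs] at hk
  refine hk.trans (le_trans ?_ (hd.2 k))
  refine (Finset.sum_le_sum_of_subset_of_nonneg (Finset.subset_univ _)
    fun _ _ _ => norm_nonneg _).trans (le_of_eq ?_)
  simp [SimpleGraph.adjMatrix_apply, apply_ite, ← SimpleGraph.card_neighborFinset_eq_degree,
    SimpleGraph.neighborFinset_eq_filter]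

variable [Nonempty V]

theorem integrable_rescaledSpectralMeasure (d : ℝ) (f : ℝ → ℝ) :
    Integrable f (rescaledSpectralMeasure G d : Measure ℝ) := by
  refine Integrable.smul_measure ?_ (by simp)
  exact integrable_finsetSum_measure.2 fun i _ => integrable_dirac (by simp)

theorem integral_pow_rescaledSpectralMeasure (d : ℝ) (k : ℕ) :
    ∫ x, x ^ k ∂(rescaledSpectralMeasure G d : Measure ℝ) = avgClosedWalks G d k 0 := by
  change ∫ x, x ^ k ∂((Fintype.card V : ℝ≥0∞)⁻¹ •
    ∑ i : V, Measure.dirac (graphEigenvalues G i / Real.sqrt d)) = _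
  rw [integral_smul_measure, integral_finsetSum_measure fun i _ => integrable_dirac (by simp),
    avgClosedWalks, pathMatrix_zero, mul_one, add_zero,
    ← (adjMatrix_isHermitian_real G).sum_eigenvalues_pow]
  simp only [integral_dirac, div_pow, ← Finset.sum_div]
  rw [ENNReal.toReal_inv, ENNReal.toReal_natCast, smul_eq_mul]
  unfold graphEigenvalues
  field_simp

variable {G} in
theorem IsAdmissible.rescaledSpectralMeasure_compl_Icc {d : ℝ} (hd : IsAdmissible G d) :
    (rescaledSpectralMeasure G d : Measure ℝ)
      (Set.Icc (-Real.sqrt d) (Real.sqrt d))ᶜ = 0 := by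
  change ((Fintype.card V : ℝ≥0∞)⁻¹ •
    ∑ i : V, Measure.dirac (graphEigenvalues G i / Real.sqrt d)) _ = 0
  have hd0 : 0 < d := by linarith [hd.1]
  have hs : 0 < Real.sqrt d := Real.sqrt_pos.2 hd0
  have h : ∀ i, graphEigenvalues G i / Real.sqrt d ∈ Set.Icc (-Real.sqrt d) (Real.sqrt d) := by
    intro i
    rw [Set.mem_Icc, ← abs_le, abs_div, abs_of_pos hs,
      div_le_iff₀ hs, Real.mul_self_sqrt hd0.le]
    exact hd.abs_graphEigenvalues_le i
  rw [Measure.smul_apply, Measure.finsetSum_apply, Finset.sum_eq_zero, smul_zero]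
  intro i _
  rw [Measure.dirac_apply' _ measurableSet_Icc.compl]
  simp [h i]

end SpectralMeasure

/-! ### Conclusion -/

theorem mainTheorem9 {V : ℕ → Type u} [∀ n, Fintype (V n)] [∀ n, DecidableEq (V n)]
    [∀ n, Nonempty (V n)] (G : ∀ n, SimpleGraph (V n)) [∀ n, DecidableRel (G n).Adj]
    (d : ℕ → ℝ) (α : ℝ) (hreg : IsRegularSeq G d α) (hgirth : HasLargeGirth G)
    (hd : Tendsto d atTop atTop) :
    (∀ n, (rescaledSpectralMeasure (G n) (d n) : Measure ℝ)
        (Set.Icc (-Real.sqrt (d n)) (Real.sqrt (d n)))ᶜ = 0) ∧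
    (∀ k : ℕ, Tendsto
      (fun n => ∫ x in Set.Icc (-Real.sqrt (d n)) (Real.sqrt (d n)),
        x ^ k ∂(rescaledSpectralMeasure (G n) (d n) : Measure ℝ))
      atTop (𝓝 (∫ x in (-2 : ℝ)..2, (Real.sqrt α * x) ^ k * semicircleDensity x))) ∧
    Tendsto (fun n => rescaledSpectralMeasure (G n) (d n)) atTop
      (𝓝 (semicircleDistribution (Real.sqrt α))) := by
  have hsupp : ∀ n, (rescaledSpectralMeasure (G n) (d n) : Measure ℝ)
      (Set.Icc (-Real.sqrt (d n)) (Real.sqrt (d n)))ᶜ = 0 := fun n =>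
    (hreg.admissible n).rescaledSpectralMeasure_compl_Icc
  have hmom : ∀ k : ℕ, Tendsto
      (fun n => ∫ x, x ^ k ∂(rescaledSpectralMeasure (G n) (d n) : Measure ℝ))
      atTop (𝓝 (∫ x in (-2 : ℝ)..2, (Real.sqrt α * x) ^ k * semicircleDensity x)) := by
    intro k
    simp_rw [integral_pow_rescaledSpectralMeasure, ← semicircleChebyshevMoment_zero_right]
    -- The Chebyshev moments with `β = √α` solve the recursion; the `k`-th moment is the entry `(k,
    -- 0)`.
    refine hreg.tendsto_avgClosedWalks hgirth hd (semicircleChebyshevMoment_zero_left _)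
      (semicircleChebyshevMoment_succ_zero _) (fun p j => ?_) k 0
    rw [semicircleChebyshevMoment_succ_succ, Real.sq_sqrt hreg.nonneg]
  refine ⟨hsupp, fun k => (hmom k).congr fun n => ?_, ?_⟩
  · have h : ∀ᵐ x ∂(rescaledSpectralMeasure (G n) (d n) : Measure ℝ),
        x ∈ Set.Icc (-Real.sqrt (d n)) (Real.sqrt (d n)) := mem_ae_iff.2 (hsupp n)
    rw [Measure.restrict_eq_self_of_ae_mem h]
  · refine tendsto_of_tendsto_moments (C := 2)
      (fun n k => integrable_rescaledSpectralMeasure _ _ _)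
      (integrable_pow_semicircleDistribution _)
      (integral_pow_semicircleDistribution_le (Real.sqrt_nonneg _)
        (Real.sqrt_le_one.2 hreg.le_one)) fun k => ?_
    rw [integral_pow_semicircleDistribution]
    exact hmom k
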